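/- Let $(X,\mathcal X)$ be a measurable space, $V:X\to[1,+\infty)$ a measurable function, and for $\beta\in[0,1]$ let $\mathcal B_\beta$ be the space of measurable $f:X\to\mathbb C$ with $\|f\|_\beta:=\sup_x V(x)^{-\beta}|f(x)|<\infty$; write $\|T\|_{\beta,\beta'}$ for the operator norm from $\mathcal B_\beta$ to $\mathcal B_{\beta'}$ and $\|T\|_1:=\|T\|_{1,1}$. Let $\varepsilon_0>0$ and let $(P_\varepsilon)_{|\varepsilon|<\varepsilon_0}$ be Markov kernels on $X$, each acting continuously on $\mathcal B_1$. Assume: (V$_1$) $P_0$ has a unique invariant probability measure $\pi_0$, $\pi_0(V)<\infty$, and $\|P_0^n-\pi_0(\cdot)1_X\|_1=O(\kappa_1^n)$ for some $\kappa_1\in(0,1)$; (D) there are $N\ge 1$, $L\in(0,\infty)$, $\delta\in(0,1)$ with $P_\varepsilon^N V\le \delta^N V+L\,1_X$ for all $|\varepsilon|<\varepsilon_0$; (C) $\lim_{\varepsilon\to0}\|P_\varepsilon-P_0\|_{0,1}=0$. Then: 1. For each $\kappa\in(\max(\kappa_1,\delta),1)$ there is $\varepsilon_1\in(0,\varepsilon_0]$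 such that for every $|\varepsilon|<\varepsilon_1$ the kernel $P_\varepsilon$ has a unique invariant probability measure $\pi_\varepsilon$, one has $\pi_\varepsilon(V)<\infty$, and $\|P_\varepsilon^n-\pi_\varepsilon(\cdot)1_X\|_1=O(\kappa^n)$. If moreover $\sup_{|\varepsilon|<\varepsilon_0}\|P_\varepsilon\|_1<\infty$ (which follows from (D) when $N=1$), then this rate is uniform in $\varepsilon$: $\sup_{|\varepsilon|<\varepsilon_1}\|P_\varepsilon^n-\pi_\varepsilon(\cdot)1_X\|_1=O(\kappa^n)$. 2. $\lim_{\varepsilon\to0}\ \sup_{\|f\|_0\le1}|\pi_\varepsilon(f)-\pi_0(f)|=0$. -/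

import Mathlib

open MeasureTheory ProbabilityTheory Filter Topology
open scoped ENNReal

noncomputable section

/-- The weighted supremum norm `‖f‖_β = sup_x V(x)^(-β) |f(x)|`, as an extended nonnegative real.
The space `B_β` consists of the measurable `f : X → ℂ` for which it is finite. -/
def weightedNorm {X : Type*} (V : X → ℝ) (β : ℝ) (f : X → ℂ) : ℝ≥0∞ :=
  ⨆ x, ENNReal.ofReal (V x ^ (-β) * ‖f x‖)

/-- The operator norm `‖T‖_{β,β'} = sup {‖T f‖_{β'} : f measurable, ‖f‖_β ≤ 1}`, as an extended
nonnegative real; for linear `T` it is finite exactly when `T` is bounded from `B_β` to `B_{β'}`. -/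
def weightedOpNorm {X : Type*} [MeasurableSpace X] (V : X → ℝ) (β β' : ℝ)
    (T : (X → ℂ) → (X → ℂ)) : ℝ≥0∞ :=
  ⨆ (f : X → ℂ) (_ : Measurable f) (_ : weightedNorm V β f ≤ 1), weightedNorm V β' (T f)

/-- The action `(P f)(x) = ∫ f(y) P(x, dy)` of a transition kernel on functions. -/
def kernelOp {X : Type*} [MeasurableSpace X] (P : Kernel X X) (f : X → ℂ) : X → ℂ :=
  fun x => ∫ y, f y ∂(P x)

/-- The operator `f ↦ μ(f) 1_X`. -/
def meanOp {X : Type*} [MeasurableSpace X] (μ : Measure X) (f : X → ℂ) : X → ℂ :=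
  fun _ => ∫ y, f y ∂μ

/-- `μ` is an invariant probability measure of `P`, and it is the only one. -/
def IsUniqueInvariantProb {X : Type*} [MeasurableSpace X] (P : Kernel X X) (μ : Measure X) :
    Prop :=
  (IsProbabilityMeasure μ ∧ P.Invariant μ) ∧
    ∀ ν : Measure X, IsProbabilityMeasure ν → P.Invariant ν → ν = μ

/-- The total variation norm `sup {|μ(f) - ν(f)| : f measurable, sup |f| ≤ 1}` of `μ - ν`. -/
def tvNormSub {X : Type*} [MeasurableSpace X] (μ ν : Measure X) : ℝ≥0∞ :=
  ⨆ (f : X → ℂ) (_ : Measurable f) (_ : ∀ x, ‖f x‖ ≤ 1), ‖(∫ y, f y ∂μ) - ∫ y, f y ∂ν‖ₑ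

end

/-! ### Weighted norms as pointwise bounds. -/

section WeightedNorm

variable {X : Type*} {V : X → ℝ}

/-! Everything is reduced to oscillations `|h x - h y| ≤ c (V x + V y)`, which ignore constants, so
no invariant measure is needed in advance. Put `Q = P ε ^ N`, `Q₀ = P 0 ^ N`, `α = δ ^ N`.

If `|f| ≤ V`, the drift condition splits `Q f` into a part bounded by `α V` and a part bounded by
`L`. The first contracts at rate `α < κ ^ N`. For the bounded part, Duhamel's formula `Q^n = Q₀^n +
∑ Q^(n-1-i) (Q - Q₀) Q₀^i` is used (`norm_osc_le_of_bounded`). The factor `(Q - Q₀) Q₀^i` is small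
from `B_0` to `B_1` for finitely many `i` by weak continuity. For the remaining `i` it is
geometrically small, because `Q₀^i f` is close to a constant and `Q - Q₀` kills constants. An
induction on `n` then closes with constants independent of `ε`
(`norm_osc_le_of_drift_of_perturbation`, `exists_uniform_contraction`).

Contraction of `P ε ^ N` passes to `P ε` at the price of a bound on `P ε` in `B_1`, the only source
of non-uniformity in `ε`. Contraction makes the laws `P^n(x₀, ·)` Cauchy uniformly over measurable
sets; their limit is the invariant measure (`exists_isUniqueInvariantProb`), and averaging one
starting point against it gives the rate. Stability follows from `π_ε(f) - π₀(f) = π_ε(P_ε^n f -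
P_0^n f) + π_ε(P_0^n f - π₀(f))` and a bound on `π_ε(V)` uniform in `ε`. -/

theorem weightedNorm_one_le_one_iff (hV : ∀ x, 1 ≤ V x) {f : X → ℂ} :
    weightedNorm V 1 f ≤ 1 ↔ ∀ x, ‖f x‖ ≤ V x := by
  simp only [weightedNorm, iSup_le_iff, ENNReal.ofReal_le_one]
  refine forall_congr' fun x => ?_
  have hx : 0 < V x := one_pos.trans_le (hV x)
  rw [Real.rpow_neg_one, inv_mul_le_iff₀ hx, mul_one]

theorem weightedNorm_one_le_iff (hV : ∀ x, 1 ≤ V x) {f : X → ℂ} {c : ℝ} (hc : 0 ≤ c) :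
    weightedNorm V 1 f ≤ ENNReal.ofReal c ↔ ∀ x, ‖f x‖ ≤ c * V x := by
  simp only [weightedNorm, iSup_le_iff]
  refine forall_congr' fun x => ?_
  have hx : 0 < V x := one_pos.trans_le (hV x)
  rw [ENNReal.ofReal_le_ofReal_iff hc, Real.rpow_neg_one, inv_mul_le_iff₀ hx, mul_comm]

theorem weightedNorm_zero_le_one_iff {f : X → ℂ} :
    weightedNorm V 0 f ≤ 1 ↔ ∀ x, ‖f x‖ ≤ 1 := by
  simp only [weightedNorm, iSup_le_iff, neg_zero, Real.rpow_zero, one_mul, ENNReal.ofReal_le_one]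

end WeightedNorm

/-! ### Integrals and operators under bounds by multiples of `V`. -/

section WeightedBounds

variable {X : Type*} [MeasurableSpace X] {V : X → ℝ}

theorem integrable_of_norm_le_mul {μ : Measure X} (hVm : Measurable V) (hV0 : ∀ x, 0 ≤ V x)
    (hμ : ∫⁻ x, ENNReal.ofReal (V x) ∂μ < ∞) {f : X → ℂ} (hf : Measurable f) {c : ℝ}
    (hfV : ∀ x, ‖f x‖ ≤ c * V x) : Integrable f μ := by
  have hVi : Integrable V μ := ⟨hVm.aestronglyMeasurable, by
    rw [hasFiniteIntegral_iff_ofReal (ae_of_all _ hV0)]; exact hμ⟩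
  exact (hVi.const_mul c).mono' hf.aestronglyMeasurable (ae_of_all _ hfV)

theorem norm_integral_le_mul {μ : Measure X} (hVm : Measurable V) (hV0 : ∀ x, 0 ≤ V x) {B : ℝ}
    (hB : 0 ≤ B) (hμ : ∫⁻ x, ENNReal.ofReal (V x) ∂μ ≤ ENNReal.ofReal B) {f : X → ℂ} {c : ℝ}
    (hc : 0 ≤ c) (hfV : ∀ x, ‖f x‖ ≤ c * V x) : ‖∫ x, f x ∂μ‖ ≤ c * B := by
  have hVi : Integrable V μ := ⟨hVm.aestronglyMeasurable, by
    rw [hasFiniteIntegral_iff_ofReal (ae_of_all _ hV0)]; exact hμ.trans_lt ENNReal.ofReal_lt_top⟩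
  calc ‖∫ x, f x ∂μ‖ ≤ ∫ x, c * V x ∂μ :=
        norm_integral_le_of_norm_le (hVi.const_mul c) (ae_of_all _ hfV)
    _ = c * ∫ x, V x ∂μ := integral_const_mul _ _
    _ ≤ c * B := by
        gcongr
        rw [integral_eq_lintegral_of_nonneg_ae (ae_of_all _ hV0) hVm.aestronglyMeasurable]
        exact ENNReal.toReal_le_of_le_ofReal hB hμ

theorem norm_integral_le_of_forall_norm_le {μ : Measure X} [IsProbabilityMeasure μ] {f : X → ℂ}
    {c : ℝ} (hf : ∀ x, ‖f x‖ ≤ c) : ‖∫ x, f x ∂μ‖ ≤ c := by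
  simpa using norm_integral_le_of_norm_le_const (μ := μ) (ae_of_all _ hf)

theorem integrable_of_forall_norm_le {μ : Measure X} [IsProbabilityMeasure μ] {f : X → ℂ}
    (hfm : Measurable f) {c : ℝ} (hf : ∀ x, ‖f x‖ ≤ c) : Integrable f μ :=
  Integrable.of_bound hfm.aestronglyMeasurable c (ae_of_all _ hf)

/-- A bound for a homogeneous functional on a ball extends to all multiples of the ball. -/
theorem norm_le_mul_of_homogeneous {T : (X → ℂ) → ℂ} (hT : ∀ (a : ℂ) f, T (a • f) = a * T f)
    {W : X → ℝ} {B : ℝ} (h : ∀ f, Measurable f → (∀ x, ‖f x‖ ≤ W x) → ‖T f‖ ≤ B) {c : ℝ}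
    (hc : 0 ≤ c) {f : X → ℂ} (hf : Measurable f) (hfW : ∀ x, ‖f x‖ ≤ c * W x) :
    ‖T f‖ ≤ c * B := by
  rcases hc.eq_or_lt with rfl | hc
  · have : f = (0 : ℂ) • f := by
      ext x
      have := hfW x
      simp only [zero_mul, norm_le_zero_iff] at this
      simp [this]
    rw [this, hT]
    simp
  · have hc' : (c : ℂ) ≠ 0 := by exact_mod_cast hc.ne'
    have hcf : f = (c : ℂ) • ((c : ℂ)⁻¹ • f) := by rw [smul_inv_smul₀ hc']
    have := h ((c : ℂ)⁻¹ • f) (hf.const_smul _) fun x => by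
      have := hfW x
      simp only [Pi.smul_apply, smul_eq_mul, norm_mul, norm_inv, Complex.norm_real,
        Real.norm_eq_abs, abs_of_pos hc]
      rwa [inv_mul_le_iff₀ hc]
    rw [hcf, hT, norm_mul, Complex.norm_real, Real.norm_eq_abs, abs_of_pos hc]
    gcongr

theorem weightedOpNorm_one_one_le_iff (hV : ∀ x, 1 ≤ V x) {T : (X → ℂ) → X → ℂ} {c : ℝ}
    (hc : 0 ≤ c) : weightedOpNorm V 1 1 T ≤ ENNReal.ofReal c ↔
      ∀ f, Measurable f → (∀ x, ‖f x‖ ≤ V x) → ∀ x, ‖T f x‖ ≤ c * V x := by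
  simp only [weightedOpNorm, iSup_le_iff, weightedNorm_one_le_one_iff hV,
    weightedNorm_one_le_iff hV hc]

theorem weightedOpNorm_zero_one_le_iff (hV : ∀ x, 1 ≤ V x) {T : (X → ℂ) → X → ℂ} {c : ℝ}
    (hc : 0 ≤ c) : weightedOpNorm V 0 1 T ≤ ENNReal.ofReal c ↔
      ∀ f, Measurable f → (∀ x, ‖f x‖ ≤ 1) → ∀ x, ‖T f x‖ ≤ c * V x := by
  simp only [weightedOpNorm, iSup_le_iff, weightedNorm_zero_le_one_iff,
    weightedNorm_one_le_iff hV hc]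

theorem lintegral_le_of_forall_lintegral_min_le {μ : Measure X} (hVm : Measurable V) {B : ℝ≥0∞}
    (h : ∀ k : ℕ, ∫⁻ y, ENNReal.ofReal (min (V y) k) ∂μ ≤ B) :
    ∫⁻ y, ENNReal.ofReal (V y) ∂μ ≤ B := by
  have hlim : ∀ y, ENNReal.ofReal (V y) = ⨆ k : ℕ, ENNReal.ofReal (min (V y) k) := by
    intro y
    refine le_antisymm ?_ (iSup_le fun k => ENNReal.ofReal_le_ofReal (min_le_left _ _))
    obtain ⟨k, hk⟩ := exists_nat_ge (V y)
    refine le_iSup_of_le k ?_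
    rw [min_eq_left hk]
  simp_rw [hlim]
  rw [lintegral_iSup (fun k => (hVm.min measurable_const).ennreal_ofReal)]
  · exact iSup_le h
  · intro a b hab y
    exact ENNReal.ofReal_le_ofReal (min_le_min_left _ (by exact_mod_cast hab))

/-- Boundedness of `P` on `B_1` forces `P V` to be finite, and bounded by a multiple of `V`. -/
theorem lintegral_le_of_weightedOpNorm_le (hVm : Measurable V) (hV : ∀ x, 1 ≤ V x)
    {P : Kernel X X} [IsMarkovKernel P] {K : ℝ} (hK : 0 ≤ K)
    (h : weightedOpNorm V 1 1 (kernelOp P) ≤ ENNReal.ofReal K) (x : X) :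
    ∫⁻ y, ENNReal.ofReal (V y) ∂P x ≤ ENNReal.ofReal (K * V x) := by
  rw [weightedOpNorm_one_one_le_iff hV hK] at h
  have hV0 : ∀ y, 0 ≤ V y := fun y => zero_le_one.trans (hV y)
  -- A Bochner integral is `0` on non-integrable functions, so the operator bound applied to `V`
  -- itself would not give finiteness; it is applied to truncations.
  refine lintegral_le_of_forall_lintegral_min_le hVm fun k => ?_
  have hm : Measurable fun y => min (V y) (k : ℝ) := hVm.min measurable_const
  have h0 : ∀ y, 0 ≤ min (V y) (k : ℝ) := fun y => le_min (hV0 y) k.cast_nonneg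
  have hi : Integrable (fun y => min (V y) (k : ℝ)) (P x) :=
    Integrable.of_bound hm.aestronglyMeasurable k (ae_of_all _ fun y => by
      rw [Real.norm_eq_abs, abs_of_nonneg (h0 y)]; exact min_le_right _ _)
  rw [← ofReal_integral_eq_lintegral_ofReal hi (ae_of_all _ h0)]
  refine ENNReal.ofReal_le_ofReal ?_
  have := h (fun y => ((min (V y) (k : ℝ) : ℝ) : ℂ)) (Complex.measurable_ofReal.comp hm)
    (fun y => by
      rw [Complex.norm_real, Real.norm_eq_abs, abs_of_nonneg (h0 y)]; exact min_le_left _ _) x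
  rw [kernelOp, integral_complex_ofReal, Complex.norm_real] at this
  exact (le_abs_self _).trans this

end WeightedBounds

/-! ### Iterates of Markov kernels acting on functions. -/

section KernelOperators

variable {X : Type*} [MeasurableSpace X] {V : X → ℝ}

instance isMarkovKernel_pow (P : Kernel X X) [IsMarkovKernel P] (n : ℕ) :
    IsMarkovKernel (P ^ n) := by
  induction n with
  | zero => rw [pow_zero]; exact inferInstanceAs (IsMarkovKernel Kernel.id)
  | succ n ih => rw [pow_succ]; exact Kernel.IsMarkovKernel.comp (P ^ n) P

theorem measurable_kernelOp (P : Kernel X X) {f : X → ℂ} (hf : Measurable f) :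
    Measurable (kernelOp P f) :=
  hf.stronglyMeasurable.integral_kernel.measurable

theorem kernelOp_smul (P : Kernel X X) (a : ℂ) (f : X → ℂ) (x : X) :
    kernelOp P (a • f) x = a * kernelOp P f x :=
  integral_const_mul a f

theorem kernelOp_one (f : X → ℂ) (hf : Measurable f) : kernelOp (1 : Kernel X X) f = f := by
  ext x
  change ∫ y, f y ∂(Kernel.id x) = f x
  rw [Kernel.id_apply]
  exact integral_dirac' f x hf.stronglyMeasurable

/-- `P * Q` is `P ∘ₖ Q`, which moves by `Q` first; the action on functions therefore reverses the
order. -/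
theorem kernelOp_mul (P Q : Kernel X X) {f : X → ℂ} {x : X} (hf : Integrable f ((P * Q) x)) :
    kernelOp (P * Q) f x = kernelOp Q (kernelOp P f) x :=
  Kernel.integral_comp (η := P) (κ := Q) hf

theorem lintegral_kernel_mul (P Q : Kernel X X) {f : X → ℝ≥0∞} (hf : Measurable f) (x : X) :
    ∫⁻ y, f y ∂(P * Q) x = ∫⁻ y, ∫⁻ z, f z ∂P y ∂Q x :=
  Kernel.lintegral_comp P Q x hf

theorem lintegral_kernel_pow_le (hVm : Measurable V) {P : Kernel X X} {K : ℝ} (hK : 0 ≤ K)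
    (h : ∀ x, ∫⁻ y, ENNReal.ofReal (V y) ∂P x ≤ ENNReal.ofReal (K * V x)) (n : ℕ) (x : X) :
    ∫⁻ y, ENNReal.ofReal (V y) ∂(P ^ n) x ≤ ENNReal.ofReal (K ^ n * V x) := by
  induction n generalizing x with
  | zero =>
    change ∫⁻ y, ENNReal.ofReal (V y) ∂(Kernel.id x) ≤ _
    rw [Kernel.id_apply, lintegral_dirac' _ hVm.ennreal_ofReal]
    simp
  | succ n ih =>
    rw [pow_succ, lintegral_kernel_mul _ _ hVm.ennreal_ofReal]
    calc ∫⁻ y, ∫⁻ z, ENNReal.ofReal (V z) ∂(P ^ n) y ∂P x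
        ≤ ∫⁻ y, ENNReal.ofReal (K ^ n) * ENNReal.ofReal (V y) ∂P x :=
          lintegral_mono fun y => (ih y).trans_eq (ENNReal.ofReal_mul (by positivity))
      _ = ENNReal.ofReal (K ^ n) * ∫⁻ y, ENNReal.ofReal (V y) ∂P x :=
          lintegral_const_mul _ hVm.ennreal_ofReal
      _ ≤ ENNReal.ofReal (K ^ n) * ENNReal.ofReal (K * V x) := by gcongr; exact h x
      _ = _ := by rw [← ENNReal.ofReal_mul (by positivity)]; ring_nf

/-- The drift inequality `P V ≤ α V + L` with `α < 1` bounds all iterates `P ^ n V`. -/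
theorem lintegral_kernel_pow_le_of_drift (hVm : Measurable V) (hV0 : ∀ x, 0 ≤ V x)
    {P : Kernel X X} [IsMarkovKernel P] {α L : ℝ} (hα : 0 ≤ α) (hα1 : α < 1) (hL : 0 ≤ L)
    (h : ∀ x, ∫⁻ y, ENNReal.ofReal (V y) ∂P x ≤ ENNReal.ofReal (α * V x + L)) (n : ℕ) (x : X) :
    ∫⁻ y, ENNReal.ofReal (V y) ∂(P ^ n) x ≤ ENNReal.ofReal (V x + L / (1 - α)) := by
  have h1α : 0 < 1 - α := by linarith
  have hq : 0 ≤ L / (1 - α) := by positivity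
  induction n generalizing x with
  | zero =>
    change ∫⁻ y, ENNReal.ofReal (V y) ∂(Kernel.id x) ≤ _
    rw [Kernel.id_apply, lintegral_dirac' _ hVm.ennreal_ofReal]
    exact ENNReal.ofReal_le_ofReal (by linarith)
  | succ n ih =>
    rw [pow_succ', lintegral_kernel_mul _ _ hVm.ennreal_ofReal]
    calc ∫⁻ y, ∫⁻ z, ENNReal.ofReal (V z) ∂P y ∂(P ^ n) x
        ≤ ∫⁻ y, (ENNReal.ofReal α * ENNReal.ofReal (V y) + ENNReal.ofReal L) ∂(P ^ n) x :=
          lintegral_mono fun y => (h y).trans_eq (by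
            rw [ENNReal.ofReal_add (mul_nonneg hα (hV0 y)) hL, ENNReal.ofReal_mul hα])
      _ = ENNReal.ofReal α * ∫⁻ y, ENNReal.ofReal (V y) ∂(P ^ n) x + ENNReal.ofReal L := by
          rw [lintegral_add_right _ measurable_const, lintegral_const_mul _ hVm.ennreal_ofReal]
          simp
      _ ≤ ENNReal.ofReal α * ENNReal.ofReal (V x + L / (1 - α)) + ENNReal.ofReal L := by
          gcongr; exact ih x
      _ = ENNReal.ofReal (α * (V x + L / (1 - α)) + L) := by
          rw [← ENNReal.ofReal_mul hα,
            ← ENNReal.ofReal_add (mul_nonneg hα (add_nonneg (hV0 x) hq)) hL]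
      _ ≤ _ := by
          refine ENNReal.ofReal_le_ofReal ?_
          have e : α * (L / (1 - α)) + L = L / (1 - α) := by field_simp; ring
          have := mul_le_mul_of_nonneg_right hα1.le (hV0 x)
          linarith

theorem norm_kernelOp_le (hVm : Measurable V) (hV0 : ∀ x, 0 ≤ V x) {P : Kernel X X} {x : X}
    {B : ℝ} (hB : 0 ≤ B) (h : ∫⁻ y, ENNReal.ofReal (V y) ∂P x ≤ ENNReal.ofReal B) {f : X → ℂ}
    {c : ℝ} (hc : 0 ≤ c) (hfV : ∀ x, ‖f x‖ ≤ c * V x) : ‖kernelOp P f x‖ ≤ c * B :=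
  norm_integral_le_mul hVm hV0 hB h hc hfV

theorem norm_kernelOp_le_of_forall_norm_le (P : Kernel X X) [IsMarkovKernel P] {f : X → ℂ} {c : ℝ}
    (hf : ∀ x, ‖f x‖ ≤ c) (x : X) : ‖kernelOp P f x‖ ≤ c :=
  norm_integral_le_of_forall_norm_le hf

theorem kernelOp_pow_add_of_bounded (P : Kernel X X) [IsMarkovKernel P] {f : X → ℂ}
    (hfm : Measurable f) {c : ℝ} (hf : ∀ x, ‖f x‖ ≤ c) (m n : ℕ) (x : X) :
    kernelOp (P ^ (m + n)) f x = kernelOp (P ^ n) (kernelOp (P ^ m) f) x := by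
  have : Integrable f ((P ^ m * P ^ n) x) := by
    rw [← pow_add]; exact integrable_of_forall_norm_le hfm hf
  rw [pow_add, kernelOp_mul _ _ this]

theorem kernelOp_pow_add (hVm : Measurable V) (hV0 : ∀ x, 0 ≤ V x) {P : Kernel X X} {K : ℝ}
    (hK : 0 ≤ K) (h : ∀ x, ∫⁻ y, ENNReal.ofReal (V y) ∂P x ≤ ENNReal.ofReal (K * V x))
    {f : X → ℂ} (hfm : Measurable f) {c : ℝ} (hf : ∀ x, ‖f x‖ ≤ c * V x) (m n : ℕ) (x : X) :
    kernelOp (P ^ (m + n)) f x = kernelOp (P ^ n) (kernelOp (P ^ m) f) x := by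
  have : Integrable f ((P ^ m * P ^ n) x) := by
    rw [← pow_add]
    exact integrable_of_norm_le_mul hVm hV0
      ((lintegral_kernel_pow_le hVm hK h _ x).trans_lt ENNReal.ofReal_lt_top) hfm hf
  rw [pow_add, kernelOp_mul _ _ this]

end KernelOperators

/-! ### Setwise limits of probability measures. -/

section SetwiseLimits

variable {X : Type*} [MeasurableSpace X]

/-- A uniform limit on measurable sets of probability measures is a probability measure. -/
theorem exists_probabilityMeasure_of_uniform_limit (ν : ℕ → Measure X)
    [∀ n, IsProbabilityMeasure (ν n)] (m : Set X → ℝ) (r : ℕ → ℝ) (hr : Tendsto r atTop (𝓝 0))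
    (h : ∀ n A, MeasurableSet A → |(ν n).real A - m A| ≤ r n) :
    ∃ π : Measure X, IsProbabilityMeasure π ∧ ∀ A, MeasurableSet A →
      Tendsto (fun n => ν n A) atTop (𝓝 (π A)) := by
  have hlim : ∀ A, MeasurableSet A → Tendsto (fun n => (ν n).real A) atTop (𝓝 (m A)) := by
    intro A hA
    rw [tendsto_iff_dist_tendsto_zero]
    exact squeeze_zero (fun n => dist_nonneg) (fun n => h n A hA) hr
  have hm0 : ∀ A, MeasurableSet A → 0 ≤ m A := fun A hA =>
    ge_of_tendsto' (hlim A hA) fun n => measureReal_nonneg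
  have hsum : ∀ ⦃A : ℕ → Set X⦄, (∀ i, MeasurableSet (A i)) → Pairwise (Function.onFun Disjoint A) →
      HasSum (fun i => m (A i)) (m (⋃ i, A i)) := by
    intro A hA hd
    rw [hasSum_iff_tendsto_nat_of_nonneg (fun i => hm0 _ (hA i))]
    have hfin : ∀ n k, ∑ i ∈ Finset.range k, (ν n).real (A i)
        = (ν n).real (⋃ i ∈ Finset.range k, A i) := fun n k =>
      (measureReal_biUnion_finset (fun i _ j _ hij => hd hij) fun i _ => hA i).symm
    -- Countable additivity is an exchange of the limits in `n` and `k`. It is legitimate because `r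
    -- n` controls the error on all finite unions at once.
    have hunif : TendstoUniformly (fun n k => ∑ i ∈ Finset.range k, (ν n).real (A i))
        (fun k => ∑ i ∈ Finset.range k, m (A i)) atTop := by
      have hval : ∀ k, ∑ i ∈ Finset.range k, m (A i) = m (⋃ i ∈ Finset.range k, A i) := by
        intro k
        have h1 := tendsto_finsetSum (Finset.range k) fun i _ => hlim (A i) (hA i)
        simp_rw [hfin] at h1
        exact tendsto_nhds_unique h1
          (hlim _ (Finset.measurableSet_biUnion _ fun i _ => hA i))
      rw [Metric.tendstoUniformly_iff]
      intro e he
      filter_upwards [hr.eventually_lt_const he] with n hn k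
      rw [hval, hfin, dist_comm]
      exact (h n _ (Finset.measurableSet_biUnion _ fun i _ => hA i)).trans_lt hn
    refine (hunif.tendstoUniformlyOnFilter.mono_right le_top).tendsto_of_eventually_tendsto
      (L := fun n => (ν n).real (⋃ i, A i)) (Eventually.of_forall fun n => ?_)
      (hlim _ (MeasurableSet.iUnion hA))
    have hne : ∑' i, ν n (A i) ≠ ∞ := by rw [← measure_iUnion hd hA]; finiteness
    have h2 := (ENNReal.hasSum_toReal hne).tendsto_sum_nat
    rwa [← ENNReal.tsum_toReal_eq (fun i => by finiteness), ← measure_iUnion hd hA] at h2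
  let π : Measure X := Measure.ofMeasurable (fun A _ => ENNReal.ofReal (m A))
    (by
      have : m ∅ = 0 := tendsto_nhds_unique (hlim ∅ .empty) (by simp)
      simp [this])
    (fun A hA hd => by
      rw [← (hsum hA hd).tsum_eq, ENNReal.ofReal_tsum_of_nonneg (fun i => hm0 _ (hA i))
        (hsum hA hd).summable])
  have hπ : ∀ A, MeasurableSet A → π A = ENNReal.ofReal (m A) := fun A hA =>
    Measure.ofMeasurable_apply A hA
  refine ⟨π, ⟨?_⟩, fun A hA => ?_⟩
  · have : m Set.univ = 1 := tendsto_nhds_unique (hlim _ .univ) (by simp)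
    rw [hπ _ .univ, this, ENNReal.ofReal_one]
  · rw [hπ A hA]
    have := ENNReal.tendsto_ofReal (hlim A hA)
    simpa [ofReal_measureReal] using this

/-- Setwise convergence of probability measures gives convergence of the integrals of bounded
measurable functions. -/
theorem tendsto_lintegral_of_tendsto_measure {ν : ℕ → Measure X} {π : Measure X}
    [∀ n, IsProbabilityMeasure (ν n)]
    (h : ∀ A, MeasurableSet A → Tendsto (fun n => ν n A) atTop (𝓝 (π A)))
    {g : X → ℝ} (hg : Measurable g) (hg0 : ∀ x, 0 ≤ g x) {c : ℝ} (hgc : ∀ x, g x ≤ c) :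
    Tendsto (fun n => ∫⁻ x, ENNReal.ofReal (g x) ∂ν n) atTop
      (𝓝 (∫⁻ x, ENNReal.ofReal (g x) ∂π)) := by
  -- The layer-cake formula reduces the claim to superlevel sets, with domination by the indicator
  -- of levels below `c`.
  simp_rw [lintegral_eq_lintegral_meas_lt _ (ae_of_all _ hg0) hg.aemeasurable]
  refine tendsto_lintegral_of_dominated_convergence' (Set.indicator (Set.Iio c) 1) (fun n => ?_)
    (fun n => ?_) ?_ ?_
  · refine (Antitone.measurable fun s t hst => ?_).aemeasurable
    exact measure_mono fun x hx => lt_of_le_of_lt hst hx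
  · refine ae_of_all _ fun t => ?_
    by_cases ht : t < c
    · simpa [ht] using prob_le_one
    · have : {a | t < g a} = ∅ := by
        ext a
        simpa using (hgc a).trans (not_lt.1 ht)
      simp [this]
  · rw [lintegral_indicator measurableSet_Iio]
    simp [Measure.restrict_restrict, Set.Iio_inter_Ioi]
  · exact ae_of_all _ fun t => h _ (measurableSet_lt measurable_const hg)

end SetwiseLimits

/-! ### Duhamel expansion and transfer of contraction from `Q₀` to `Q`. -/

section Perturbation

variable {X : Type*} [MeasurableSpace X] {V : X → ℝ}

theorem kernelOp_sub_apply (P : Kernel X X) {f g : X → ℂ} {x : X} (hf : Integrable f (P x))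
    (hg : Integrable g (P x)) : kernelOp P (f - g) x = kernelOp P f x - kernelOp P g x :=
  integral_sub hf hg

theorem kernelOp_add_apply (P : Kernel X X) {f g : X → ℂ} {x : X} (hf : Integrable f (P x))
    (hg : Integrable g (P x)) : kernelOp P (f + g) x = kernelOp P f x + kernelOp P g x :=
  integral_add hf hg

/-- Discrete Duhamel estimate for the difference of two starting points: if the oscillation of
`Q ^ k` on the unit ball of `B_1` is at most `B k`, and `Q - Q₀` maps `Q₀ ^ j f` into the ball of
radius `w j`, then the oscillation of `Q ^ n` on bounded functions is controlled by that of `Q₀`. -/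
theorem norm_osc_le_of_bounded {Q Q₀ : Kernel X X} [IsMarkovKernel Q] [IsMarkovKernel Q₀]
    {w : ℕ → ℝ} (hw0 : ∀ j, 0 ≤ w j)
    (hw : ∀ j f, Measurable f → (∀ x, ‖f x‖ ≤ 1) → ∀ x,
      ‖kernelOp Q (kernelOp (Q₀ ^ j) f) x - kernelOp Q₀ (kernelOp (Q₀ ^ j) f) x‖ ≤ w j * V x)
    (x y : X) (B : ℕ → ℝ) (n : ℕ)
    (hB : ∀ k < n, ∀ f, Measurable f → (∀ z, ‖f z‖ ≤ V z) →
      ‖kernelOp (Q ^ k) f x - kernelOp (Q ^ k) f y‖ ≤ B k)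
    {f : X → ℂ} (hfm : Measurable f) (hf : ∀ z, ‖f z‖ ≤ 1) (j : ℕ) :
    ‖kernelOp (Q ^ n) (kernelOp (Q₀ ^ j) f) x - kernelOp (Q ^ n) (kernelOp (Q₀ ^ j) f) y‖ ≤
      ‖kernelOp (Q₀ ^ (n + j)) f x - kernelOp (Q₀ ^ (n + j)) f y‖ +
        ∑ i ∈ Finset.range n, w (j + i) * B (n - 1 - i) := by
  induction n generalizing j with
  | zero =>
    rw [pow_zero, kernelOp_one _ (measurable_kernelOp _ hfm)]
    simp
  | succ n ih =>
    set g := kernelOp (Q₀ ^ j) f with hg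
    have hgm : Measurable g := measurable_kernelOp _ hfm
    have hg1 : ∀ z, ‖g z‖ ≤ 1 := norm_kernelOp_le_of_forall_norm_le _ hf
    have hQ₀g : kernelOp (Q₀ ^ (j + 1)) f = kernelOp Q₀ g := by
      ext z; rw [kernelOp_pow_add_of_bounded _ hfm hf, pow_one]
    have hQg1 : ∀ z, ‖kernelOp Q g z‖ ≤ 1 := norm_kernelOp_le_of_forall_norm_le _ hg1
    have hQ₀g1 : ∀ z, ‖kernelOp Q₀ g z‖ ≤ 1 := norm_kernelOp_le_of_forall_norm_le _ hg1
    -- One Duhamel step: the innermost `Q` is replaced by `Q₀`, which raises `j` by one; this is why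
    -- the induction generalizes `j`.
    have hsplit : ∀ z, kernelOp (Q ^ (n + 1)) g z =
        kernelOp (Q ^ n) (kernelOp (Q₀ ^ (j + 1)) f) z +
          kernelOp (Q ^ n) (kernelOp Q g - kernelOp Q₀ g) z := by
      intro z
      rw [add_comm n 1, kernelOp_pow_add_of_bounded _ hgm hg1, pow_one, hQ₀g,
        kernelOp_sub_apply _ (integrable_of_forall_norm_le (measurable_kernelOp _ hgm) hQg1)
          (integrable_of_forall_norm_le (measurable_kernelOp _ hgm) hQ₀g1)]
      ring
    have hdiff : ‖kernelOp (Q ^ n) (kernelOp Q g - kernelOp Q₀ g) x -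
        kernelOp (Q ^ n) (kernelOp Q g - kernelOp Q₀ g) y‖ ≤ w j * B n :=
      norm_le_mul_of_homogeneous
        (T := fun h => kernelOp (Q ^ n) h x - kernelOp (Q ^ n) h y)
        (fun a h => by simp only [kernelOp_smul]; ring) (hB n n.lt_succ_self) (hw0 j)
        ((measurable_kernelOp _ hgm).sub (measurable_kernelOp _ hgm)) (hw j f hfm hf)
    have hih := ih (fun k hk => hB k (hk.trans n.lt_succ_self)) (j + 1)
    rw [hsplit, hsplit, add_sub_add_comm, Finset.sum_range_succ', ← add_assoc]
    refine (norm_add_le _ _).trans (add_le_add ?_ ?_)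
    · refine hih.trans (le_of_eq ?_)
      congr 1
      · rw [show n + (j + 1) = n + 1 + j by ring]
      · refine Finset.sum_congr rfl fun i _ => ?_
        rw [show j + 1 + i = j + (i + 1) by ring, show n + 1 - 1 - (i + 1) = n - 1 - i by omega]
    · simpa using hdiff

/-- Geometric contraction of the iterates of `Q`, when `Q` satisfies a drift inequality and is a
small perturbation of a geometrically contracting kernel `Q₀`. -/
theorem norm_osc_le_of_drift_of_perturbation {Q Q₀ : Kernel X X} [IsMarkovKernel Q]
    [IsMarkovKernel Q₀] (hVm : Measurable V) (hV : ∀ x, 1 ≤ V x) {α L : ℝ} (hα : 0 < α)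
    (hL : 0 ≤ L)
    (hQ : ∀ x, ∫⁻ y, ENNReal.ofReal (V y) ∂Q x ≤ ENNReal.ofReal (α * V x + L))
    {κ θ C M : ℝ} (hκ : 0 < κ) {w : ℕ → ℝ} (hw0 : ∀ j, 0 ≤ w j)
    (hw : ∀ j f, Measurable f → (∀ x, ‖f x‖ ≤ 1) → ∀ x,
      ‖kernelOp Q (kernelOp (Q₀ ^ j) f) x - kernelOp Q₀ (kernelOp (Q₀ ^ j) f) x‖ ≤ w j * V x)
    (hgeo : ∀ n f, Measurable f → (∀ x, ‖f x‖ ≤ 1) → ∀ x y,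
      ‖kernelOp (Q₀ ^ n) f x - kernelOp (Q₀ ^ n) f y‖ ≤ C * κ ^ n * (V x + V y))
    (hθ : ∀ n, ∑ j ∈ Finset.range n, w j * κ⁻¹ ^ (j + 1) ≤ θ)
    (hM1 : 1 ≤ M) (hM : α * M + L * (C + M * θ) ≤ κ * M) (n : ℕ) {f : X → ℂ}
    (hfm : Measurable f) (hf : ∀ x, ‖f x‖ ≤ V x) (x y : X) :
    ‖kernelOp (Q ^ n) f x - kernelOp (Q ^ n) f y‖ ≤ M * κ ^ n * (V x + V y) := by
  have hV0 : ∀ x, 0 ≤ V x := fun x => zero_le_one.trans (hV x)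
  have hK : ∀ x, ∫⁻ y, ENNReal.ofReal (V y) ∂Q x ≤ ENNReal.ofReal ((α + L) * V x) := fun x =>
    (hQ x).trans (ENNReal.ofReal_le_ofReal (by nlinarith [hV x]))
  have hs : 0 ≤ V x + V y := add_nonneg (hV0 x) (hV0 y)
  -- Strong induction, since the Duhamel sum involves every earlier iterate of `Q`.
  induction n using Nat.strong_induction_on generalizing f with
  | _ n ih =>
    rcases n with _ | n
    · rw [pow_zero, kernelOp_one f hfm, pow_zero, mul_one]
      calc ‖f x - f y‖ ≤ ‖f x‖ + ‖f y‖ := norm_sub_le _ _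
        _ ≤ 1 * (V x + V y) := by rw [one_mul]; exact add_le_add (hf x) (hf y)
        _ ≤ _ := by gcongr
    · have hweak : ∀ g, Measurable g → (∀ z, ‖g z‖ ≤ 1) →
          ‖kernelOp (Q ^ n) g x - kernelOp (Q ^ n) g y‖ ≤
            (C + M * θ) * κ ^ n * (V x + V y) := by
        intro g hgm hg
        have h := norm_osc_le_of_bounded hw0 hw x y (fun k => M * κ ^ k * (V x + V y)) n
          (fun k hk g hgm hg => ih k (hk.trans n.lt_succ_self) hgm hg) hgm hg 0
        rw [pow_zero, kernelOp_one g hgm, add_zero] at h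
        refine h.trans ?_
        have hsum : ∑ i ∈ Finset.range n, w (0 + i) * (M * κ ^ (n - 1 - i) * (V x + V y)) =
            M * κ ^ n * (V x + V y) * ∑ j ∈ Finset.range n, w j * κ⁻¹ ^ (j + 1) := by
          rw [Finset.mul_sum]
          refine Finset.sum_congr rfl fun i hi => ?_
          have hi' := Finset.mem_range.1 hi
          have : κ ^ n = κ ^ (n - 1 - i) * κ ^ (i + 1) := by rw [← pow_add]; congr 1; omega
          rw [zero_add, this, inv_pow]
          field_simp
        rw [hsum]
        have h1 := hgeo n g hgm hg x y
        have h2 : M * κ ^ n * (V x + V y) * ∑ j ∈ Finset.range n, w j * κ⁻¹ ^ (j + 1) ≤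
            M * κ ^ n * (V x + V y) * θ := by
          gcongr
          exact hθ n
        linarith
      set g := kernelOp Q f with hg
      have hgm : Measurable g := measurable_kernelOp _ hfm
      have hgb : ∀ z, ‖g z‖ ≤ α * V z + L := fun z => by
        have := norm_kernelOp_le hVm hV0 (add_nonneg (mul_nonneg hα.le (hV0 z)) hL) (hQ z)
          zero_le_one (f := f) (by simpa using hf)
        simpa using this
      have hden : ∀ z, 0 < α * V z + L := fun z =>
        add_pos_of_pos_of_nonneg (mul_pos hα (one_pos.trans_le (hV z))) hL
      -- `g` is divided in the proportion `α V : L`, so that the bound `|g| ≤ α V + L` splits into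
      -- one bound for each piece.
      let g₁ : X → ℂ := fun z => ((α * V z / (α * V z + L) : ℝ) : ℂ) * g z
      let g₂ : X → ℂ := fun z => ((L / (α * V z + L) : ℝ) : ℂ) * g z
      have hg₁m : Measurable g₁ := by fun_prop
      have hg₂m : Measurable g₂ := by fun_prop
      have hgsum : g = g₁ + g₂ := by
        ext z
        have h1 : α * V z / (α * V z + L) + L / (α * V z + L) = 1 := by
          rw [← add_div, div_self (hden z).ne']
        have : g z = ((α * V z / (α * V z + L) + L / (α * V z + L) : ℝ) : ℂ) * g z := by
          rw [h1]; simp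
        rw [this]
        simp only [g₁, g₂, Pi.add_apply]
        push_cast
        ring
      have hg₁ : ∀ z, ‖g₁ z‖ ≤ α * V z := fun z => by
        have h0 : 0 ≤ α * V z := mul_nonneg hα.le (hV0 z)
        simp only [g₁, norm_mul, Complex.norm_real, Real.norm_eq_abs,
          abs_of_nonneg (div_nonneg h0 (hden z).le)]
        rw [div_mul_eq_mul_div, div_le_iff₀ (hden z)]
        exact mul_le_mul_of_nonneg_left (hgb z) h0
      have hg₂ : ∀ z, ‖g₂ z‖ ≤ L * 1 := fun z => by
        simp only [g₂, norm_mul, Complex.norm_real, Real.norm_eq_abs,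
          abs_of_nonneg (div_nonneg hL (hden z).le), mul_one]
        rw [div_mul_eq_mul_div, div_le_iff₀ (hden z)]
        exact mul_le_mul_of_nonneg_left (hgb z) hL
      have hsplit : ∀ z, kernelOp (Q ^ (n + 1)) f z =
          kernelOp (Q ^ n) g₁ z + kernelOp (Q ^ n) g₂ z := by
        intro z
        have hi : ∀ h : X → ℂ, Measurable h → ∀ c : ℝ, (∀ z, ‖h z‖ ≤ c * V z) →
            Integrable h ((Q ^ n) z) := fun h hm c hc => integrable_of_norm_le_mul hVm hV0
          ((lintegral_kernel_pow_le hVm (by positivity) hK n z).trans_lt ENNReal.ofReal_lt_top)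
          hm hc
        rw [add_comm n 1, kernelOp_pow_add hVm hV0 (K := α + L) (by positivity) hK hfm (c := 1)
          (by simpa using hf), pow_one, ← hg, hgsum]
        exact kernelOp_add_apply _ (hi g₁ hg₁m α hg₁) (integrable_of_forall_norm_le hg₂m hg₂)
      have hT : ∀ (a : ℂ) (h : X → ℂ), kernelOp (Q ^ n) (a • h) x - kernelOp (Q ^ n) (a • h) y =
          a * (kernelOp (Q ^ n) h x - kernelOp (Q ^ n) h y) := fun a h => by
        simp only [kernelOp_smul]; ring
      have e₁ := norm_le_mul_of_homogeneous hT (W := V)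
        (fun h hm hh => ih n n.lt_succ_self hm hh) hα.le hg₁m hg₁
      have e₂ := norm_le_mul_of_homogeneous hT (W := fun _ => 1) hweak hL hg₂m hg₂
      rw [hsplit, hsplit, add_sub_add_comm]
      calc _ ≤ α * (M * κ ^ n * (V x + V y)) + L * ((C + M * θ) * κ ^ n * (V x + V y)) :=
            (norm_add_le _ _).trans (add_le_add e₁ e₂)
        _ = (α * M + L * (C + M * θ)) * (κ ^ n * (V x + V y)) := by ring
        _ ≤ (κ * M) * (κ ^ n * (V x + V y)) := by gcongr
        _ = _ := by ring

/-- Powers of two close kernels are close as operators from `B_0` to `B_1`. -/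
theorem norm_kernelOp_pow_sub_le {P P₀ : Kernel X X} [IsMarkovKernel P] [IsMarkovKernel P₀]
    (hVm : Measurable V) (hV0 : ∀ x, 0 ≤ V x) {K τ : ℝ} (hK : 0 ≤ K) (hτ : 0 ≤ τ)
    (hP₀ : ∀ x, ∫⁻ y, ENNReal.ofReal (V y) ∂P₀ x ≤ ENNReal.ofReal (K * V x))
    (h : ∀ f, Measurable f → (∀ x, ‖f x‖ ≤ 1) → ∀ x,
      ‖kernelOp P f x - kernelOp P₀ f x‖ ≤ τ * V x) (n : ℕ) {f : X → ℂ} (hfm : Measurable f)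
    (hf : ∀ x, ‖f x‖ ≤ 1) (x : X) :
    ‖kernelOp (P ^ n) f x - kernelOp (P₀ ^ n) f x‖ ≤
      τ * (∑ k ∈ Finset.range n, K ^ k) * V x := by
  induction n generalizing x with
  | zero => simp
  | succ n ih =>
    have hg1 : ∀ z, ‖kernelOp (P ^ n) f z‖ ≤ 1 := norm_kernelOp_le_of_forall_norm_le _ hf
    have hg2 : ∀ z, ‖kernelOp (P₀ ^ n) f z‖ ≤ 1 := norm_kernelOp_le_of_forall_norm_le _ hf
    have hm1 := measurable_kernelOp (P ^ n) hfm
    have hm2 := measurable_kernelOp (P₀ ^ n) hfm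
    have e := kernelOp_sub_apply P₀ (x := x) (integrable_of_forall_norm_le hm1 hg1)
      (integrable_of_forall_norm_le hm2 hg2)
    have hsum : 0 ≤ ∑ k ∈ Finset.range n, K ^ k := Finset.sum_nonneg fun _ _ => by positivity
    have h2 := norm_kernelOp_le hVm hV0 (mul_nonneg hK (hV0 x)) (hP₀ x)
      (mul_nonneg hτ hsum) (f := kernelOp (P ^ n) f - kernelOp (P₀ ^ n) f) ih
    -- Telescoping as `(P - P₀) P^n + P₀ (P^n - P₀^n)` puts `P₀` outside, so only the growth
    -- constant of `P₀` enters and the bound is uniform in `P`.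
    rw [kernelOp_pow_add_of_bounded _ hfm hf, kernelOp_pow_add_of_bounded _ hfm hf, pow_one,
      pow_one, geom_sum_succ,
      ← sub_add_sub_cancel _ (kernelOp P₀ (kernelOp (P ^ n) f) x), ← e]
    refine (norm_add_le _ _).trans ((add_le_add (h _ hm1 hg1 x) h2).trans (le_of_eq ?_))
    ring

end Perturbation

/-! ### Choice of constants, passage from `P ^ N` to `P`, consequences of invariance. -/

section Ergodicity

variable {X : Type*} [MeasurableSpace X] {V : X → ℝ}

/-- Markov kernels fix constants; this allows recentring at the limit value before applying a
kernel. -/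
theorem kernelOp_sub_const (P : Kernel X X) [IsMarkovKernel P] {f : X → ℂ} {x : X}
    (hf : Integrable f (P x)) (a : ℂ) :
    kernelOp P (fun y => f y - a) x = kernelOp P f x - a := by
  simp [kernelOp, integral_sub hf (integrable_const a)]

/-- Supplies the smallness of the weighted Duhamel sum: `m` makes the tail of `a` at most `θ / 2`,
then `τ` makes the first `m` terms at most `θ / 2`. -/
theorem exists_sum_range_ite_le {b a : ℕ → ℝ} (hb : ∀ j, 0 ≤ b j) (ha : ∀ j, 0 ≤ a j)
    (hs : Summable a) {θ : ℝ} (hθ : 0 < θ) :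
    ∃ m : ℕ, ∃ τ > 0, ∀ n, ∑ j ∈ Finset.range n, (if j < m then τ * b j else a j) ≤ θ := by
  obtain ⟨m, hm⟩ := ((tendsto_sum_nat_add a).eventually_lt_const (half_pos hθ)).exists
  have hS : 0 ≤ ∑ j ∈ Finset.range m, b j := Finset.sum_nonneg fun j _ => hb j
  have hτ : 0 < θ / 2 / (∑ j ∈ Finset.range m, b j + 1) := by positivity
  refine ⟨m, _, hτ, fun n => ?_⟩
  set τ := θ / 2 / (∑ j ∈ Finset.range m, b j + 1) with hτdef
  calc ∑ j ∈ Finset.range n, (if j < m then τ * b j else a j)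
      ≤ ∑ j ∈ Finset.range (m + n), (if j < m then τ * b j else a j) := by
        refine Finset.sum_le_sum_of_subset_of_nonneg
          (Finset.range_mono (Nat.le_add_left n m)) fun j _ _ => ?_
        split_ifs
        · exact mul_nonneg hτ.le (hb j)
        · exact ha j
    _ = τ * ∑ j ∈ Finset.range m, b j + ∑ j ∈ Finset.range n, a (j + m) := by
        rw [Finset.sum_range_add, Finset.mul_sum]
        congr 1
        · exact Finset.sum_congr rfl fun j hj => if_pos (Finset.mem_range.1 hj)
        · exact Finset.sum_congr rfl fun j _ => by
            rw [if_neg (by omega), add_comm]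
    _ ≤ θ / 2 + θ / 2 := by
        gcongr
        · calc τ * ∑ j ∈ Finset.range m, b j ≤ τ * (∑ j ∈ Finset.range m, b j + 1) := by
                gcongr; linarith
            _ = θ / 2 := by rw [hτdef]; field_simp
        · exact (((summable_nat_add_iff m).2 hs).sum_le_tsum _ fun j _ => ha _).trans hm.le
    _ = θ := add_halves θ

/-- All kernels satisfying a common drift inequality and sufficiently close to a geometrically
ergodic kernel contract at any rate `κ` larger than both the drift rate and the ergodic rate. -/
theorem exists_uniform_contraction {Q₀ : Kernel X X} [IsMarkovKernel Q₀] (hVm : Measurable V)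
    (hV : ∀ x, 1 ≤ V x) {α L κ ρ C : ℝ} (hα : 0 < α) (hL : 0 ≤ L) (hακ : α < κ) (hρ : 0 < ρ)
    (hρκ : ρ < κ) (hC : 0 ≤ C)
    (hQ₀ : ∀ x, ∫⁻ y, ENNReal.ofReal (V y) ∂Q₀ x ≤ ENNReal.ofReal (α * V x + L))
    (p : (X → ℂ) → ℂ) (hp : ∀ n f, Measurable f → (∀ x, ‖f x‖ ≤ 1) → ∀ x,
      ‖kernelOp (Q₀ ^ n) f x - p f‖ ≤ C * ρ ^ n * V x) :
    ∃ τ > 0, ∃ M, 1 ≤ M ∧ ∀ Q : Kernel X X, IsMarkovKernel Q →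
      (∀ x, ∫⁻ y, ENNReal.ofReal (V y) ∂Q x ≤ ENNReal.ofReal (α * V x + L)) →
      (∀ f, Measurable f → (∀ x, ‖f x‖ ≤ 1) → ∀ x,
        ‖kernelOp Q f x - kernelOp Q₀ f x‖ ≤ τ * V x) →
      ∀ n f, Measurable f → (∀ x, ‖f x‖ ≤ V x) → ∀ x y,
        ‖kernelOp (Q ^ n) f x - kernelOp (Q ^ n) f y‖ ≤ M * κ ^ n * (V x + V y) := by
  have hV0 : ∀ x, 0 ≤ V x := fun x => zero_le_one.trans (hV x)
  have hκ : 0 < κ := hα.trans hακ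
  have hd : 0 < κ - α := by linarith
  -- The gap `κ - α` is shared equally: this `θ` gives `L * θ ≤ (κ - α) / 2`, and `M` below gives `L
  -- * C ≤ (κ - α) / 2 * M`. Together they yield the closing inequality of the induction.
  set θ := (κ - α) / (2 * (L + 1)) with hθdef
  have hθ : 0 < θ := by positivity
  have hLθ : L * θ ≤ (κ - α) / 2 := by
    calc L * θ ≤ (L + 1) * θ := by gcongr; linarith
      _ = _ := by rw [hθdef]; field_simp
  have hsum : Summable fun j : ℕ => 2 * (α + L) * C * ρ ^ j * κ⁻¹ ^ (j + 1) := by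
    have h1 : Summable fun j : ℕ => (ρ / κ) ^ j :=
      summable_geometric_of_lt_one (by positivity) ((div_lt_one hκ).2 hρκ)
    refine (h1.mul_left (2 * (α + L) * C * κ⁻¹)).congr fun j => ?_
    rw [div_pow, inv_pow, pow_succ]
    field_simp
  obtain ⟨m, τ, hτ, hm⟩ := exists_sum_range_ite_le (b := fun j => κ⁻¹ ^ (j + 1))
    (fun j => by positivity) (fun j => by positivity) hsum hθ
  refine ⟨τ, hτ, max 1 (2 * L * C / (κ - α)), le_max_left _ _, fun Q hQM hQ hQQ₀ => ?_⟩
  intro n f hfm hf x y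
  refine norm_osc_le_of_drift_of_perturbation (Q₀ := Q₀) hVm hV hα hL hQ (θ := θ) (C := C) hκ
    (w := fun j => if j < m then τ else 2 * (α + L) * C * ρ ^ j) (fun j => ?_) ?_ ?_
    (fun n => ?_) (le_max_left _ _) ?_ n hfm hf x y
  · split_ifs <;> positivity
  · intro j g hgm hg z
    have hg1 : ∀ z, ‖kernelOp (Q₀ ^ j) g z‖ ≤ 1 := norm_kernelOp_le_of_forall_norm_le _ hg
    have hgm1 := measurable_kernelOp (Q₀ ^ j) hgm
    split_ifs
    · exact hQQ₀ _ hgm1 hg1 z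
    -- For `j ≥ m` closeness of `Q` to `Q₀` is not used: both send `Q₀ ^ j g` near the same constant
    -- `p g`.
    · have key : ∀ T : Kernel X X, IsMarkovKernel T →
          (∀ x, ∫⁻ y, ENNReal.ofReal (V y) ∂T x ≤ ENNReal.ofReal (α * V x + L)) →
          ‖kernelOp T (kernelOp (Q₀ ^ j) g) z - p g‖ ≤ C * ρ ^ j * ((α + L) * V z) := by
        intro T hTM hT
        rw [← kernelOp_sub_const T (integrable_of_forall_norm_le hgm1 hg1)]
        exact norm_kernelOp_le hVm hV0 (mul_nonneg (by positivity) (hV0 z))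
          ((hT z).trans (ENNReal.ofReal_le_ofReal (by nlinarith [hV z])))
          (by positivity) (hp j g hgm hg)
      rw [← sub_sub_sub_cancel_right _ _ (p g)]
      refine (norm_sub_le _ _).trans ((add_le_add (key Q hQM hQ) (key Q₀ ‹_› hQ₀)).trans
        (le_of_eq (by ring)))
  · intro n g hgm hg x y
    rw [← sub_sub_sub_cancel_right _ _ (p g)]
    have hle : ρ ^ n ≤ κ ^ n := pow_le_pow_left₀ hρ.le hρκ.le n
    calc _ ≤ C * ρ ^ n * V x + C * ρ ^ n * V y :=
          (norm_sub_le _ _).trans (add_le_add (hp n g hgm hg x) (hp n g hgm hg y))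
      _ = C * ρ ^ n * (V x + V y) := by ring
      _ ≤ _ := by
        have := add_nonneg (hV0 x) (hV0 y)
        gcongr
  · refine le_trans (le_of_eq (Finset.sum_congr rfl fun j _ => ?_)) (hm n)
    split_ifs <;> rfl
  · set M := max 1 (2 * L * C / (κ - α)) with hMdef
    have hM0 : 0 ≤ M := zero_le_one.trans (le_max_left _ _)
    have h1 : 2 * L * C / (κ - α) ≤ M := le_max_right _ _
    rw [div_le_iff₀ hd] at h1
    have h2 := mul_le_mul_of_nonneg_left hLθ hM0
    nlinarith

/-- Contraction of `P ^ N` gives contraction of `P`, with the corresponding rate. -/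
theorem norm_osc_le_of_pow {P : Kernel X X} [IsMarkovKernel P] (hVm : Measurable V)
    (hV : ∀ x, 1 ≤ V x) {K κ M : ℝ} (hK : 1 ≤ K) (hκ : 0 < κ) (hκ1 : κ ≤ 1) (hM : 0 ≤ M)
    (hP : ∀ x, ∫⁻ y, ENNReal.ofReal (V y) ∂P x ≤ ENNReal.ofReal (K * V x)) {N : ℕ} (hN : 1 ≤ N)
    (h : ∀ n f, Measurable f → (∀ x, ‖f x‖ ≤ V x) → ∀ x y,
      ‖kernelOp ((P ^ N) ^ n) f x - kernelOp ((P ^ N) ^ n) f y‖ ≤ M * (κ ^ N) ^ n * (V x + V y))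
    (n : ℕ) {f : X → ℂ} (hfm : Measurable f) (hf : ∀ x, ‖f x‖ ≤ V x) (x y : X) :
    ‖kernelOp (P ^ n) f x - kernelOp (P ^ n) f y‖ ≤
      K ^ N * M * (κ ^ N)⁻¹ * κ ^ n * (V x + V y) := by
  have hV0 : ∀ x, 0 ≤ V x := fun x => zero_le_one.trans (hV x)
  have hK0 : 0 ≤ K := zero_le_one.trans hK
  have hs : 0 ≤ V x + V y := add_nonneg (hV0 x) (hV0 y)
  have hr : n % N ≤ N := (Nat.mod_lt n hN).le
  have hn : n = n % N + N * (n / N) := (Nat.mod_add_div n N).symm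
  have hdec : ∀ z, kernelOp (P ^ n) f z =
      kernelOp ((P ^ N) ^ (n / N)) (kernelOp (P ^ (n % N)) f) z := fun z => by
    rw [← pow_mul, ← kernelOp_pow_add hVm hV0 hK0 hP hfm (c := 1) (by simpa using hf), ← hn]
  have hg : ∀ z, ‖kernelOp (P ^ (n % N)) f z‖ ≤ K ^ N * V z := fun z => by
    have h1 := norm_kernelOp_le hVm hV0 (mul_nonneg (by positivity) (hV0 z))
      (lintegral_kernel_pow_le hVm hK0 hP (n % N) z) zero_le_one (f := f) (by simpa using hf)
    rw [one_mul] at h1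
    exact h1.trans (mul_le_mul_of_nonneg_right (pow_le_pow_right₀ hK hr) (hV0 z))
  have h2 := norm_le_mul_of_homogeneous
    (T := fun g => kernelOp ((P ^ N) ^ (n / N)) g x - kernelOp ((P ^ N) ^ (n / N)) g y)
    (fun a g => by simp only [kernelOp_smul]; ring) (fun g hgm hg => h (n / N) g hgm hg x y)
    (pow_nonneg hK0 N) (measurable_kernelOp _ hfm) hg
  rw [hdec, hdec]
  refine h2.trans ?_
  -- Rounding `n` down to a multiple of `N` loses at most `N` powers of `κ`.
  have h3 : (κ ^ N) ^ (n / N) ≤ (κ ^ N)⁻¹ * κ ^ n := by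
    rw [le_inv_mul_iff₀ (by positivity), ← pow_mul, ← pow_add]
    exact pow_le_pow_of_le_one hκ.le hκ1 (by omega)
  calc K ^ N * (M * (κ ^ N) ^ (n / N) * (V x + V y))
      ≤ K ^ N * (M * ((κ ^ N)⁻¹ * κ ^ n) * (V x + V y)) := by gcongr
    _ = _ := by ring

theorem invariant_pow {P : Kernel X X} {μ : Measure X} (h : P.Invariant μ) (n : ℕ) :
    (P ^ n).Invariant μ := by
  induction n with
  | zero => exact Measure.bind_dirac
  | succ n ih => rw [pow_succ]; exact ih.comp h

theorem lintegral_eq_of_invariant {P : Kernel X X} {μ : Measure X} (h : P.Invariant μ)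
    {f : X → ℝ≥0∞} (hf : Measurable f) : ∫⁻ x, ∫⁻ y, f y ∂P x ∂μ = ∫⁻ x, f x ∂μ := by
  conv_rhs => rw [← h.def]
  rw [Measure.lintegral_bind P.aemeasurable hf.aemeasurable]

theorem integral_kernelOp_of_invariant {P : Kernel X X} {μ : Measure X} (h : P.Invariant μ)
    {f : X → ℂ} (hf : Integrable f μ) : ∫ x, kernelOp P f x ∂μ = ∫ x, f x ∂μ := by
  have e : (P ∘ₖ Kernel.const Unit μ) () = μ := by
    rw [Kernel.comp_const, h.def, Kernel.const_apply]
  have := Kernel.integral_comp (η := P) (κ := Kernel.const Unit μ) (a := ()) (f := f)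
    (by rwa [e])
  rw [e, Kernel.const_apply] at this
  exact this.symm

/-- An invariant probability measure integrating `V` satisfies the bound given by the drift. -/
theorem lintegral_le_of_invariant_of_drift (hVm : Measurable V) (hV0 : ∀ x, 0 ≤ V x)
    {Q : Kernel X X} {π : Measure X} [IsProbabilityMeasure π] (hinv : Q.Invariant π) {α L : ℝ}
    (hα : 0 ≤ α) (hα1 : α < 1) (hL : 0 ≤ L)
    (hQ : ∀ x, ∫⁻ y, ENNReal.ofReal (V y) ∂Q x ≤ ENNReal.ofReal (α * V x + L))
    (hfin : ∫⁻ x, ENNReal.ofReal (V x) ∂π < ∞) :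
    ∫⁻ x, ENNReal.ofReal (V x) ∂π ≤ ENNReal.ofReal (L / (1 - α)) := by
  have h1α : 0 < 1 - α := by linarith
  have h := calc ∫⁻ x, ENNReal.ofReal (V x) ∂π
      = ∫⁻ x, ∫⁻ y, ENNReal.ofReal (V y) ∂Q x ∂π :=
        (lintegral_eq_of_invariant hinv hVm.ennreal_ofReal).symm
    _ ≤ ∫⁻ x, (ENNReal.ofReal α * ENNReal.ofReal (V x) + ENNReal.ofReal L) ∂π :=
        lintegral_mono fun x => (hQ x).trans_eq (by
          rw [ENNReal.ofReal_add (mul_nonneg hα (hV0 x)) hL, ENNReal.ofReal_mul hα])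
    _ = ENNReal.ofReal α * ∫⁻ x, ENNReal.ofReal (V x) ∂π + ENNReal.ofReal L := by
        rw [lintegral_add_right _ measurable_const, lintegral_const_mul _ hVm.ennreal_ofReal]
        simp
  -- Finiteness of `π(V)` is what allows `v ≤ α v + L` to be solved for `v`.
  rw [← ENNReal.ofReal_toReal hfin.ne] at h ⊢
  set v := (∫⁻ x, ENNReal.ofReal (V x) ∂π).toReal with hv
  have hv0 : 0 ≤ v := ENNReal.toReal_nonneg
  rw [← ENNReal.ofReal_mul hα, ← ENNReal.ofReal_add (mul_nonneg hα hv0) hL,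
    ENNReal.ofReal_le_ofReal_iff (by positivity)] at h
  refine ENNReal.ofReal_le_ofReal ?_
  rw [le_div_iff₀ h1α]
  linarith

/-- Averaging one of the two starting points in a contraction estimate. -/
theorem norm_sub_integral_le_of_osc {μ : Measure X} [IsProbabilityMeasure μ] (hVm : Measurable V)
    (hV0 : ∀ x, 0 ≤ V x) {R : ℝ} (hR : 0 ≤ R)
    (hμ : ∫⁻ x, ENNReal.ofReal (V x) ∂μ ≤ ENNReal.ofReal R) {c : ℝ} (hc : 0 ≤ c) {h : X → ℂ}
    (hi : Integrable h μ) (x : X) (hosc : ∀ y, ‖h x - h y‖ ≤ c * (V x + V y)) :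
    ‖h x - ∫ y, h y ∂μ‖ ≤ c * (V x + R) := by
  have e : h x - ∫ y, h y ∂μ = ∫ y, (h x - h y) ∂μ := by
    rw [integral_sub (integrable_const _) hi]; simp
  rw [e]
  refine norm_integral_le_mul (V := fun y => V x + V y) (hVm.const_add _)
    (fun y => add_nonneg (hV0 x) (hV0 y)) (add_nonneg (hV0 x) hR) ?_ hc hosc
  calc ∫⁻ y, ENNReal.ofReal (V x + V y) ∂μ
      = ENNReal.ofReal (V x) + ∫⁻ y, ENNReal.ofReal (V y) ∂μ := by
        simp_rw [ENNReal.ofReal_add (hV0 x) (hV0 _)]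
        rw [lintegral_add_left measurable_const]; simp
    _ ≤ _ := by rw [ENNReal.ofReal_add (hV0 x) hR]; gcongr

theorem kernelOp_indicator (P : Kernel X X) {A : Set X} (hA : MeasurableSet A) (x : X) :
    kernelOp P (A.indicator 1) x = ((P x).real A : ℂ) := by
  rw [kernelOp, integral_indicator hA]
  simp

end Ergodicity

/-! ### Existence, uniqueness, rate and stability of the invariant measure. -/

section InvariantMeasure

variable {X : Type*} [MeasurableSpace X] {V : X → ℝ}

/-- A Markov kernel with geometrically contracting iterates and bounded `V`-moments along the
multiples of `N` has a unique invariant probability measure, which integrates `V`. -/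
theorem exists_isUniqueInvariantProb [Nonempty X] {P : Kernel X X} [IsMarkovKernel P]
    (hVm : Measurable V) (hV : ∀ x, 1 ≤ V x) {K C κ R : ℝ} (hK : 0 ≤ K) (hκ : 0 < κ) (hκ1 : κ < 1)
    (hC : 0 ≤ C) (hP : ∀ x, ∫⁻ y, ENNReal.ofReal (V y) ∂P x ≤ ENNReal.ofReal (K * V x))
    (hosc : ∀ n f, Measurable f → (∀ x, ‖f x‖ ≤ V x) → ∀ x y,
      ‖kernelOp (P ^ n) f x - kernelOp (P ^ n) f y‖ ≤ C * κ ^ n * (V x + V y))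
    {N : ℕ} (hN : 1 ≤ N)
    (hmom : ∀ n x, ∫⁻ y, ENNReal.ofReal (V y) ∂(P ^ (N * n)) x ≤ ENNReal.ofReal (V x + R)) :
    ∃ π : Measure X, IsUniqueInvariantProb P π ∧ ∫⁻ x, ENNReal.ofReal (V x) ∂π < ∞ := by
  have hV0 : ∀ x, 0 ≤ V x := fun x => zero_le_one.trans (hV x)
  have hind : ∀ (A : Set X) x, ‖A.indicator (1 : X → ℂ) x‖ ≤ 1 := fun A x => by
    by_cases hx : x ∈ A <;> simp [hx]
  have hindm : ∀ {A : Set X}, MeasurableSet A → Measurable (A.indicator (1 : X → ℂ)) := fun hA =>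
    measurable_one.indicator hA
  let x₀ : X := Classical.arbitrary X
  -- The law `P^(n+1)(x₀, ·)` averages `P^n(y, ·)` over `P(x₀, dy)`, so the oscillation bound
  -- controls the increment, with a constant independent of `A`.
  have hstep : ∀ A, MeasurableSet A → ∀ n, dist (((P ^ n) x₀).real A) (((P ^ (n + 1)) x₀).real A) ≤
      C * (V x₀ + K * V x₀) * κ ^ n := by
    intro A hA n
    have hi : Integrable (kernelOp (P ^ n) (A.indicator 1)) (P x₀) :=
      integrable_of_forall_norm_le (measurable_kernelOp _ (hindm hA))
        (norm_kernelOp_le_of_forall_norm_le _ (hind A))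
    have h := norm_sub_integral_le_of_osc hVm hV0 (mul_nonneg hK (hV0 x₀)) (hP x₀)
      (by positivity) hi x₀ fun y => hosc n _ (hindm hA) (fun z => (hind A z).trans (hV z)) x₀ y
    change ‖_ - kernelOp P _ x₀‖ ≤ _ at h
    have e := kernelOp_pow_add_of_bounded P (hindm hA) (hind A) n 1 x₀
    rw [pow_one] at e
    rw [← e, kernelOp_indicator _ hA, kernelOp_indicator _ hA, ← Complex.ofReal_sub,
      Complex.norm_real] at h
    rw [Real.dist_eq, ← Real.norm_eq_abs]
    exact h.trans (le_of_eq (by ring))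
  choose! m hm using fun (A : Set X) (hA : MeasurableSet A) =>
    cauchySeq_tendsto_of_complete (cauchySeq_of_le_geometric κ _ hκ1 (hstep A hA))
  obtain ⟨π, hπ, hlim⟩ := exists_probabilityMeasure_of_uniform_limit (fun n => (P ^ n) x₀) m
    (fun n => C * (V x₀ + K * V x₀) * κ ^ n / (1 - κ))
    (by
      have := (tendsto_pow_atTop_nhds_zero_of_lt_one hκ.le hκ1).const_mul
        (C * (V x₀ + K * V x₀))
      simpa using this.div_const (1 - κ))
    (fun n A hA => by
      rw [← Real.dist_eq]
      exact dist_le_of_le_geometric_of_tendsto κ _ hκ1 (hstep A hA) (hm A hA) n)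
  -- The limit does not depend on the starting point.
  have hlim' : ∀ A, MeasurableSet A → ∀ x, Tendsto (fun n => (P ^ n) x A) atTop (𝓝 (π A)) := by
    intro A hA x
    have h0 : Tendsto (fun n => ((P ^ n) x).real A - ((P ^ n) x₀).real A) atTop (𝓝 0) := by
      refine squeeze_zero_norm (a := fun n => C * κ ^ n * (V x + V x₀)) (fun n => ?_) ?_
      · have h := hosc n _ (hindm hA) (fun z => (hind A z).trans (hV z)) x x₀
        rwa [kernelOp_indicator _ hA, kernelOp_indicator _ hA, ← Complex.ofReal_sub,
          Complex.norm_real] at h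
      · have := ((tendsto_pow_atTop_nhds_zero_of_lt_one hκ.le hκ1).const_mul C).mul_const
          (V x + V x₀)
        simpa using this
    have h1 : Tendsto (fun n => ((P ^ n) x₀).real A) atTop (𝓝 (π.real A)) :=
      (ENNReal.tendsto_toReal (by finiteness)).comp (hlim A hA)
    have h2 := ENNReal.tendsto_ofReal (h0.add h1)
    simpa [ofReal_measureReal] using h2
  refine ⟨π, ⟨⟨hπ, ?_⟩, fun ν hν hinv => ?_⟩, ?_⟩
  -- Invariance: integrating `y ↦ P(y, A)` against `P^n(x₀, ·)` gives `P^(n+1)(x₀, A)`, and both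
  -- sides converge.
  · refine Measure.ext fun A hA => ?_
    rw [Measure.bind_apply hA P.aemeasurable]
    have h1 := tendsto_lintegral_of_tendsto_measure hlim (g := fun y => (P y).real A)
      (P.measurable_coe hA).ennreal_toReal (fun _ => measureReal_nonneg) (c := 1)
      (fun _ => measureReal_le_one)
    simp only [ofReal_measureReal (measure_ne_top _ _)] at h1
    refine tendsto_nhds_unique h1 (((tendsto_add_atTop_iff_nat 1).2 (hlim A hA)).congr fun n => ?_)
    rw [pow_succ']
    exact Kernel.comp_apply' P (P ^ n) x₀ hA
  -- Uniqueness: `ν(A) = ∫ P^n(y, A) dν` tends to `π(A)` by dominated convergence, with no moment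
  -- condition on `ν`.
  · refine Measure.ext fun A hA => ?_
    have h1 : Tendsto (fun n => ∫⁻ y, (P ^ n) y A ∂ν) atTop (𝓝 (∫⁻ _, π A ∂ν)) :=
      tendsto_lintegral_of_dominated_convergence (fun _ => 1)
        (fun n => (P ^ n).measurable_coe hA) (fun n => ae_of_all _ fun y => prob_le_one)
        (by simp) (ae_of_all _ fun y => hlim' A hA y)
    have h2 : ∀ n, ∫⁻ y, (P ^ n) y A ∂ν = ν A := fun n => by
      rw [← Measure.bind_apply hA (P ^ n).aemeasurable, (invariant_pow hinv n).def]
    simp only [h2, lintegral_const, measure_univ, mul_one] at h1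
    exact tendsto_nhds_unique tendsto_const_nhds h1
  · refine lt_of_le_of_lt (lintegral_le_of_forall_lintegral_min_le hVm fun k => ?_)
      (ENNReal.ofReal_lt_top (r := V x₀ + R))
    have h1 := tendsto_lintegral_of_tendsto_measure hlim (g := fun y => min (V y) k)
      (hVm.min measurable_const) (fun y => le_min (hV0 y) k.cast_nonneg)
      (fun _ => min_le_right _ _)
    have hsub : Tendsto (fun n : ℕ => N * n) atTop atTop :=
      tendsto_id.const_mul_atTop' hN
    refine le_of_tendsto' (h1.comp hsub) fun n => le_trans ?_ (hmom n x₀)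
    exact lintegral_mono fun y => ENNReal.ofReal_le_ofReal (min_le_left _ _)

/-- Contraction of the iterates of `P` around an invariant probability measure. -/
theorem weightedOpNorm_pow_sub_meanOp_le {P : Kernel X X} (hVm : Measurable V)
    (hV : ∀ x, 1 ≤ V x) {K C κ R : ℝ} (hK : 0 ≤ K) (hκ : 0 < κ) (hC : 0 ≤ C) (hR : 0 ≤ R)
    (hP : ∀ x, ∫⁻ y, ENNReal.ofReal (V y) ∂P x ≤ ENNReal.ofReal (K * V x))
    (hosc : ∀ n f, Measurable f → (∀ x, ‖f x‖ ≤ V x) → ∀ x y,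
      ‖kernelOp (P ^ n) f x - kernelOp (P ^ n) f y‖ ≤ C * κ ^ n * (V x + V y))
    {π : Measure X} [IsProbabilityMeasure π] (hinv : P.Invariant π)
    (hπ : ∫⁻ x, ENNReal.ofReal (V x) ∂π ≤ ENNReal.ofReal R) (n : ℕ) :
    weightedOpNorm V 1 1 (kernelOp (P ^ n) - meanOp π) ≤
      ENNReal.ofReal (C * (1 + R) * κ ^ n) := by
  have hV0 : ∀ x, 0 ≤ V x := fun x => zero_le_one.trans (hV x)
  rw [weightedOpNorm_one_one_le_iff hV (by positivity)]
  intro f hfm hf x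
  have hπt := hπ.trans_lt ENNReal.ofReal_lt_top
  have hfi : Integrable f π :=
    integrable_of_norm_le_mul hVm hV0 hπt hfm (c := 1) (by simpa using hf)
  have hgi : Integrable (kernelOp (P ^ n) f) π :=
    integrable_of_norm_le_mul hVm hV0 hπt (measurable_kernelOp _ hfm) (c := K ^ n) fun z => by
      simpa using norm_kernelOp_le hVm hV0 (mul_nonneg (by positivity) (hV0 z))
        (lintegral_kernel_pow_le hVm hK hP n z) zero_le_one (f := f) (by simpa using hf)
  have h := norm_sub_integral_le_of_osc hVm hV0 hR hπ (by positivity) hgi x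
    fun y => hosc n f hfm hf x y
  rw [integral_kernelOp_of_invariant (invariant_pow hinv n) hfi] at h
  refine h.trans ?_
  calc C * κ ^ n * (V x + R) ≤ C * κ ^ n * ((1 + R) * V x) := by
        gcongr
        nlinarith [hV x]
    _ = _ := by ring

/-- Comparison of the invariant measures of two kernels through their `n`-th iterates. -/
theorem tvNormSub_le_of_pow {P P₀ : Kernel X X} [IsMarkovKernel P] (hVm : Measurable V)
    (hV0 : ∀ x, 0 ≤ V x) {π π₀ : Measure X} [IsProbabilityMeasure π] (hinv : P.Invariant π)
    {R a b : ℝ} (hR : 0 ≤ R) (ha : 0 ≤ a) (hb : 0 ≤ b)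
    (hπ : ∫⁻ x, ENNReal.ofReal (V x) ∂π ≤ ENNReal.ofReal R) (n : ℕ)
    (h₁ : ∀ f, Measurable f → (∀ x, ‖f x‖ ≤ 1) → ∀ x,
      ‖kernelOp (P ^ n) f x - kernelOp (P₀ ^ n) f x‖ ≤ a * V x)
    (h₂ : ∀ f, Measurable f → (∀ x, ‖f x‖ ≤ 1) → ∀ x,
      ‖kernelOp (P₀ ^ n) f x - ∫ y, f y ∂π₀‖ ≤ b * V x) :
    tvNormSub π π₀ ≤ ENNReal.ofReal ((a + b) * R) := by
  refine iSup_le fun f => iSup_le fun hfm => iSup_le fun hf => ?_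
  rw [← ofReal_norm]
  refine ENNReal.ofReal_le_ofReal ?_
  have hgi : Integrable (kernelOp (P ^ n) f) π := integrable_of_forall_norm_le
    (measurable_kernelOp _ hfm) (norm_kernelOp_le_of_forall_norm_le _ hf)
  -- Invariance of `π` replaces `f` by `P^n f` under the integral.
  have e : (∫ y, f y ∂π) - ∫ y, f y ∂π₀ = ∫ x, (kernelOp (P ^ n) f x - ∫ y, f y ∂π₀) ∂π := by
    rw [integral_sub hgi (integrable_const _), integral_kernelOp_of_invariant
      (invariant_pow hinv n) (integrable_of_forall_norm_le hfm hf)]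
    simp
  rw [e]
  refine norm_integral_le_mul hVm hV0 hR hπ (add_nonneg ha hb) fun x => ?_
  rw [← sub_add_sub_cancel _ (kernelOp (P₀ ^ n) f x), add_mul]
  exact (norm_add_le _ _).trans (add_le_add (h₁ f hfm hf x) (h₂ f hfm hf x))

end InvariantMeasure

/-! ### Assembly of the theorem. -/

theorem theorem1 {X : Type*} [MeasurableSpace X]
    (V : X → ℝ) (hVmeas : Measurable V) (hV : ∀ x, 1 ≤ V x)
    (ε₀ : ℝ) (hε₀ : 0 < ε₀)
    (P : ℝ → Kernel X X)
    (hMarkov : ∀ ε ∈ Set.Ioo (-ε₀) ε₀, IsMarkovKernel (P ε))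
    -- each `P ε` acts continuously on `B_1`
    (hact : ∀ ε ∈ Set.Ioo (-ε₀) ε₀, weightedOpNorm V 1 1 (kernelOp (P ε)) < ∞)
    -- `P 0` is `V`-geometrically ergodic
    (π₀ : Measure X) (hπ₀ : IsUniqueInvariantProb (P 0) π₀)
    (hπ₀V : ∫⁻ x, ENNReal.ofReal (V x) ∂π₀ < ∞)
    (κ₁ : ℝ) (hκ₁ : κ₁ ∈ Set.Ioo (0 : ℝ) 1)
    (hV₁ : ∃ c : ℝ, ∀ n : ℕ,
      weightedOpNorm V 1 1 (kernelOp (P 0 ^ n) - meanOp π₀) ≤ ENNReal.ofReal (c * κ₁ ^ n))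
    -- the uniform drift condition
    (N : ℕ) (hN : 1 ≤ N) (L : ℝ) (hL : 0 < L) (δ : ℝ) (hδ : δ ∈ Set.Ioo (0 : ℝ) 1)
    (hD : ∀ ε ∈ Set.Ioo (-ε₀) ε₀, ∀ x,
      ∫⁻ y, ENNReal.ofReal (V y) ∂((P ε ^ N) x) ≤ ENNReal.ofReal (δ ^ N * V x + L))
    -- the weak continuity condition
    (hcont : Tendsto (fun ε : ℝ => weightedOpNorm V 0 1 (kernelOp (P ε) - kernelOp (P 0)))
      (𝓝 0) (𝓝 0)) :
    ∃ π : ℝ → Measure X,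
      (∀ κ ∈ Set.Ioo (max κ₁ δ) 1, ∃ ε₁ ∈ Set.Ioc (0 : ℝ) ε₀,
        (∀ ε ∈ Set.Ioo (-ε₁) ε₁,
          IsUniqueInvariantProb (P ε) (π ε) ∧
          ∫⁻ x, ENNReal.ofReal (V x) ∂(π ε) < ∞ ∧
          ∃ C : ℝ, ∀ n : ℕ,
            weightedOpNorm V 1 1 (kernelOp (P ε ^ n) - meanOp (π ε))
              ≤ ENNReal.ofReal (C * κ ^ n)) ∧
        -- the rate is uniform in `ε` as soon as the norms of `P ε` on `B_1` are bounded
        -- (which the drift condition contains when `N = 1`)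
        ((⨆ ε ∈ Set.Ioo (-ε₀) ε₀, weightedOpNorm V 1 1 (kernelOp (P ε))) < ∞ →
          ∃ C : ℝ, ∀ n : ℕ,
            (⨆ ε ∈ Set.Ioo (-ε₁) ε₁,
              weightedOpNorm V 1 1 (kernelOp (P ε ^ n) - meanOp (π ε)))
              ≤ ENNReal.ofReal (C * κ ^ n))) ∧
      Tendsto (fun ε : ℝ => tvNormSub (π ε) π₀) (𝓝 0) (𝓝 0) := by
  classical
  have hV0 : ∀ x, 0 ≤ V x := fun x => zero_le_one.trans (hV x)
  have h0mem : (0 : ℝ) ∈ Set.Ioo (-ε₀) ε₀ := ⟨by linarith, hε₀⟩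
  have : IsProbabilityMeasure π₀ := hπ₀.1.1
  have : Nonempty X := nonempty_of_isProbabilityMeasure π₀
  have : IsMarkovKernel (P 0) := hMarkov 0 h0mem
  have hα : 0 < δ ^ N := pow_pos hδ.1 N
  have hα1 : δ ^ N < 1 := pow_lt_one₀ hδ.1.le hδ.2 (by omega)
  have hR : 0 ≤ L / (1 - δ ^ N) := div_nonneg hL.le (by linarith)
  set R := L / (1 - δ ^ N) with hRdef
  obtain ⟨c₀, hc₀⟩ := hV₁
  obtain ⟨c, hc, hgeo⟩ : ∃ c : ℝ, 0 ≤ c ∧ ∀ n f, Measurable f → (∀ x, ‖f x‖ ≤ 1) → ∀ x,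
      ‖kernelOp (P 0 ^ n) f x - ∫ y, f y ∂π₀‖ ≤ c * κ₁ ^ n * V x := by
    refine ⟨max c₀ 0, le_max_right _ _, fun n f hfm hf => ?_⟩
    have hκn : 0 ≤ κ₁ ^ n := pow_nonneg hκ₁.1.le n
    exact (weightedOpNorm_one_one_le_iff hV (mul_nonneg (le_max_right _ _) hκn)).1
      ((hc₀ n).trans (ENNReal.ofReal_le_ofReal
        (mul_le_mul_of_nonneg_right (le_max_left _ _) hκn))) f hfm fun x => (hf x).trans (hV x)
  have hbound : ∀ ε ∈ Set.Ioo (-ε₀) ε₀, ∀ K : ℝ, 1 ≤ K →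
      weightedOpNorm V 1 1 (kernelOp (P ε)) ≤ ENNReal.ofReal K →
      ∀ x, ∫⁻ y, ENNReal.ofReal (V y) ∂(P ε) x ≤ ENNReal.ofReal (K * V x) := fun ε hε K hK h => by
    have := hMarkov ε hε
    exact lintegral_le_of_weightedOpNorm_le hVmeas hV (zero_le_one.trans hK) h
  have hbd : ∀ ε ∈ Set.Ioo (-ε₀) ε₀, ∃ K : ℝ, 1 ≤ K ∧
      ∀ x, ∫⁻ y, ENNReal.ofReal (V y) ∂(P ε) x ≤ ENNReal.ofReal (K * V x) := fun ε hε => by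
    refine ⟨max 1 (weightedOpNorm V 1 1 (kernelOp (P ε))).toReal, le_max_left _ _,
      hbound ε hε _ (le_max_left _ _) ?_⟩
    rw [ENNReal.le_ofReal_iff_toReal_le (hact ε hε).ne (zero_le_one.trans (le_max_left _ _))]
    exact le_max_right _ _
  obtain ⟨K₀, hK₀, hP₀⟩ := hbd 0 h0mem
  -- closeness of the `n`-th iterates near `0`
  have hclose : ∀ n : ℕ, ∀ τ > 0, ∀ᶠ ε in 𝓝 (0 : ℝ), ε ∈ Set.Ioo (-ε₀) ε₀ ∧
      ∀ f, Measurable f → (∀ x, ‖f x‖ ≤ 1) → ∀ x,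
        ‖kernelOp (P ε ^ n) f x - kernelOp (P 0 ^ n) f x‖ ≤ τ * V x := by
    intro n τ hτ
    have hS : 0 ≤ ∑ k ∈ Finset.range n, K₀ ^ k := Finset.sum_nonneg fun _ _ => by positivity
    set S := ∑ k ∈ Finset.range n, K₀ ^ k with hSdef
    have hτS : 0 < τ / (S + 1) := by positivity
    filter_upwards [Ioo_mem_nhds h0mem.1 h0mem.2,
      hcont.eventually_le_const (ENNReal.ofReal_pos.2 hτS)] with ε hε h
    refine ⟨hε, fun f hfm hf x => ?_⟩
    have := hMarkov ε hε
    rw [weightedOpNorm_zero_one_le_iff hV hτS.le] at h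
    refine (norm_kernelOp_pow_sub_le hVmeas hV0 (zero_le_one.trans hK₀) hτS.le hP₀ h n hfm hf
      x).trans (mul_le_mul_of_nonneg_right ?_ (hV0 x))
    rw [← hSdef, div_mul_eq_mul_div, div_le_iff₀ (by positivity)]
    nlinarith
  -- uniform contraction of `P ε ^ N` near `0`
  have hcontr : ∀ κ ∈ Set.Ioo (max κ₁ δ) 1, ∃ ε₁ ∈ Set.Ioc (0 : ℝ) ε₀, ∃ M, 1 ≤ M ∧
      ∀ ε ∈ Set.Ioo (-ε₁) ε₁, ∀ n f, Measurable f → (∀ x, ‖f x‖ ≤ V x) → ∀ x y,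
        ‖kernelOp ((P ε ^ N) ^ n) f x - kernelOp ((P ε ^ N) ^ n) f y‖ ≤
          M * (κ ^ N) ^ n * (V x + V y) := by
    intro κ hκ
    have hκ₁κ : κ₁ < κ := (le_max_left _ _).trans_lt hκ.1
    have hδκ : δ < κ := (le_max_right _ _).trans_lt hκ.1
    obtain ⟨τ, hτ, M, hM, h⟩ := exists_uniform_contraction (Q₀ := P 0 ^ N) hVmeas hV hα hL.le
      (pow_lt_pow_left₀ hδκ hδ.1.le (by omega)) (pow_pos hκ₁.1 N)
      (pow_lt_pow_left₀ hκ₁κ hκ₁.1.le (by omega)) hc (hD 0 h0mem) (fun f => ∫ y, f y ∂π₀)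
      (fun n f hfm hf x => by
        rw [← pow_mul, ← pow_mul]
        exact hgeo _ f hfm hf x)
    obtain ⟨r, hr, hball⟩ := Metric.eventually_nhds_iff.1 (hclose N τ hτ)
    refine ⟨min r ε₀, ⟨lt_min hr hε₀, min_le_right _ _⟩, M, hM, fun ε hε => ?_⟩
    have hε' := hball (y := ε) (by
      rw [Real.dist_eq, sub_zero]
      exact (abs_lt.2 hε).trans_le (min_le_left _ _))
    have := hMarkov ε hε'.1
    exact h (P ε ^ N) inferInstance (hD ε hε'.1) hε'.2
  have hsub : ∀ {ε₁ : ℝ}, ε₁ ∈ Set.Ioc (0 : ℝ) ε₀ → ∀ ε ∈ Set.Ioo (-ε₁) ε₁,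
      ε ∈ Set.Ioo (-ε₀) ε₀ := fun hε₁ ε hε =>
    ⟨by linarith [hε.1, hε₁.2], hε.2.trans_le hε₁.2⟩
  let π : ℝ → Measure X := fun ε =>
    if h : ∃ μ, IsUniqueInvariantProb (P ε) μ ∧ ∫⁻ x, ENNReal.ofReal (V x) ∂μ < ∞
    then h.choose else 0
  have hπspec : ∀ ε, (∃ μ, IsUniqueInvariantProb (P ε) μ ∧ ∫⁻ x, ENNReal.ofReal (V x) ∂μ < ∞) →
      IsUniqueInvariantProb (P ε) (π ε) ∧ ∫⁻ x, ENNReal.ofReal (V x) ∂(π ε) < ∞ := fun ε h => by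
    simp only [π, dif_pos h]
    exact h.choose_spec
  have hπR : ∀ ε ∈ Set.Ioo (-ε₀) ε₀,
      IsUniqueInvariantProb (P ε) (π ε) ∧ ∫⁻ x, ENNReal.ofReal (V x) ∂(π ε) < ∞ →
      ∫⁻ x, ENNReal.ofReal (V x) ∂(π ε) ≤ ENNReal.ofReal R := fun ε hε h => by
    have := h.1.1.1
    exact lintegral_le_of_invariant_of_drift hVmeas hV0 (invariant_pow h.1.1.2 N) hα.le hα1 hL.le
      (hD ε hε) h.2
  -- the rate at a single parameter, in terms of a bound `K` on `P ε`
  have hmain : ∀ κ ∈ Set.Ioo (max κ₁ δ) 1, ∃ ε₁ ∈ Set.Ioc (0 : ℝ) ε₀, ∃ M, 1 ≤ M ∧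
      ∀ ε ∈ Set.Ioo (-ε₁) ε₁,
        (IsUniqueInvariantProb (P ε) (π ε) ∧ ∫⁻ x, ENNReal.ofReal (V x) ∂(π ε) < ∞) ∧
        ∀ K : ℝ, 1 ≤ K →
          (∀ x, ∫⁻ y, ENNReal.ofReal (V y) ∂(P ε) x ≤ ENNReal.ofReal (K * V x)) →
          ∀ n : ℕ, weightedOpNorm V 1 1 (kernelOp (P ε ^ n) - meanOp (π ε)) ≤
            ENNReal.ofReal (K ^ N * M * (κ ^ N)⁻¹ * (1 + R) * κ ^ n) := by
    intro κ hκ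
    have hκ0 : 0 < κ := hκ₁.1.trans ((le_max_left _ _).trans_lt hκ.1)
    obtain ⟨ε₁, hε₁, M, hM, hosc⟩ := hcontr κ hκ
    have hM0 : 0 ≤ M := zero_le_one.trans hM
    refine ⟨ε₁, hε₁, M, hM, fun ε hε => ?_⟩
    have hε' := hsub hε₁ ε hε
    have := hMarkov ε hε'
    have hosc' : ∀ K : ℝ, 1 ≤ K →
        (∀ x, ∫⁻ y, ENNReal.ofReal (V y) ∂(P ε) x ≤ ENNReal.ofReal (K * V x)) →
        ∀ n f, Measurable f → (∀ x, ‖f x‖ ≤ V x) → ∀ x y,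
          ‖kernelOp (P ε ^ n) f x - kernelOp (P ε ^ n) f y‖ ≤
            K ^ N * M * (κ ^ N)⁻¹ * κ ^ n * (V x + V y) := fun K hK hPK n f hfm hf x y =>
      norm_osc_le_of_pow hVmeas hV hK hκ0 hκ.2.le hM0 hPK hN (hosc ε hε) n hfm hf x y
    have hspec : IsUniqueInvariantProb (P ε) (π ε) ∧ ∫⁻ x, ENNReal.ofReal (V x) ∂(π ε) < ∞ := by
      obtain ⟨K, hK, hPK⟩ := hbd ε hε'
      refine hπspec ε (exists_isUniqueInvariantProb hVmeas hV (zero_le_one.trans hK) hκ0 hκ.2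
        (by positivity) hPK (hosc' K hK hPK) hN (R := R) fun n x => ?_)
      rw [pow_mul]
      exact lintegral_kernel_pow_le_of_drift hVmeas hV0 hα.le hα1 hL.le (hD ε hε') n x
    refine ⟨hspec, fun K hK hPK n => ?_⟩
    have := hspec.1.1.1
    exact weightedOpNorm_pow_sub_meanOp_le hVmeas hV (zero_le_one.trans hK) hκ0 (by positivity) hR
      hPK (hosc' K hK hPK) hspec.1.1.2 (hπR ε hε' hspec) n
  refine ⟨π, fun κ hκ => ?_, ?_⟩
  · obtain ⟨ε₁, hε₁, M, hM, h⟩ := hmain κ hκ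
    refine ⟨ε₁, hε₁, fun ε hε => ?_, fun hsup => ?_⟩
    · obtain ⟨K, hK, hPK⟩ := hbd ε (hsub hε₁ ε hε)
      exact ⟨(h ε hε).1.1, (h ε hε).1.2, _, (h ε hε).2 K hK hPK⟩
    -- `M` is already uniform in `ε`, so a single `K` for all `ε` makes the whole constant uniform.
    · set s := ⨆ ε ∈ Set.Ioo (-ε₀) ε₀, weightedOpNorm V 1 1 (kernelOp (P ε)) with hs
      refine ⟨(max 1 s.toReal) ^ N * M * (κ ^ N)⁻¹ * (1 + R), fun n =>
        iSup₂_le fun ε hε => (h ε hε).2 _ (le_max_left _ _) ?_ n⟩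
      refine hbound ε (hsub hε₁ ε hε) _ (le_max_left _ _) ?_
      calc weightedOpNorm V 1 1 (kernelOp (P ε)) ≤ s :=
            le_iSup₂ (f := fun ε _ => weightedOpNorm V 1 1 (kernelOp (P ε))) ε (hsub hε₁ ε hε)
        _ = ENNReal.ofReal s.toReal := (ENNReal.ofReal_toReal hsup.ne).symm
        _ ≤ _ := ENNReal.ofReal_le_ofReal (le_max_right _ _)
  · obtain ⟨κ, hκ⟩ := exists_between (max_lt hκ₁.2 hδ.2)
    obtain ⟨ε₁, hε₁, M, hM, h⟩ := hmain κ hκ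
    refine ENNReal.tendsto_nhds_zero.2 fun e he => ?_
    obtain ⟨e', he'0, he'⟩ : ∃ e' : ℝ, 0 < e' ∧ ENNReal.ofReal e' ≤ e := by
      obtain ⟨q, hq0, hqe⟩ := ENNReal.lt_iff_exists_nnreal_btwn.1 he
      exact ⟨q, by exact_mod_cast hq0, by simpa using hqe.le⟩
    set η := e' / (2 * (R + 1)) with hη
    have hη0 : 0 < η := by positivity
    -- The order of choices matters: `n` is fixed from the ergodicity of `P 0`, and only then is `ε`
    -- taken small enough for that `n`.
    obtain ⟨n, hn⟩ : ∃ n : ℕ, c * κ₁ ^ n ≤ η := by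
      have := (tendsto_pow_atTop_nhds_zero_of_lt_one hκ₁.1.le hκ₁.2).const_mul c
      rw [mul_zero] at this
      exact (this.eventually_le_const hη0).exists
    filter_upwards [hclose n η hη0, Ioo_mem_nhds (neg_lt_zero.2 hε₁.1) hε₁.1] with ε hε hε1
    have hspec := (h ε hε1).1
    have := hspec.1.1.1
    have := hMarkov ε hε.1
    refine (tvNormSub_le_of_pow hVmeas hV0 hspec.1.1.2 hR hη0.le hη0.le (hπR ε hε.1 hspec) n hε.2
      fun f hfm hf x => (hgeo n f hfm hf x).trans
        (mul_le_mul_of_nonneg_right hn (hV0 x))).trans (le_trans ?_ he')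
    refine ENNReal.ofReal_le_ofReal ?_
    calc (η + η) * R ≤ (η + η) * (R + 1) := by gcongr; linarith
      _ = e' := by rw [hη]; field_simp; ring
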